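/- Let $a=(a_1,\dots,a_{g_a})$ and $x=(x_1,\dots,x_{g_x})$ be noncommuting variables. Equip the real noncommutative polynomials $\mathbb R\langle a,x\rangle$ with the linear involution ${}^T$ that reverses words and fixes every variable. For tuples $A$, $X$ of symmetric real $n\times n$ matrices, $p(A,X)$ denotes the matrix obtained by substituting $A_i$ for $a_i$ and $X_j$ for $x_j$; $M\succeq 0$ means that $M$ is symmetric and positive semidefinite. Let $p(a,x)\in\mathbb R\langle a,x\rangle$ be symmetric, i.e. $p^T=p$. Suppose that $p$ is (globally) convex in $x$: for every $n$, all tuples $A,X,Y$ of symmetric $n\times n$ matrices and all $0<t<1$, $$t\,p(A,X)+(1-t)\,p(A,Y)-p(A,tX+(1-t)Y)\succeq 0,$$ and that $p$ is (globally) concave in $a$: for every $n$, all tuples $A,B,X$ of symmetric $n\times n$ matrices and all $0<t<1$, $$p(tA+(1-t)B,X)-\bigl(t\,p(A,X)+(1-t)\,p(B,X)\bigr)\succeq 0.$$ Then there exist finitely many polynomials $r_j(x)$ in the variables $x$ only and finitely many polynomials $s_l(a)$ in the variables $a$ only, all linear (homogeneous of degree one), and a polynomial $L(a,x)$ of degree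 at most one in $a$ and of degree at most one in $x$ (hence of joint degree at most two), such that $$p(a,x)=L(a,x)+R(x)^TR(x)-S(a)^TS(a),$$ where $R(x)^TR(x)=\sum_j r_j(x)^Tr_j(x)$ and $S(a)^TS(a)=\sum_l s_l(a)^Ts_l(a)$. -/

import Mathlib

/-- Real polynomials in the noncommuting variables `a_1, …, a_ga` and `x_1, …, x_gx`.
Mathlib's involution `star` on it is `ℝ`-linear, reverses words and fixes every variable. -/
abbrev NCPoly (ga gx : ℕ) : Type := FreeAlgebra ℝ (Fin ga ⊕ Fin gx)

namespace NCPoly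

/-- The coefficient of the word `w` in the polynomial `p`. -/
noncomputable def coeff {ga gx : ℕ} (p : NCPoly ga gx) (w : FreeMonoid (Fin ga ⊕ Fin gx)) : ℝ :=
  (FreeAlgebra.equivMonoidAlgebraFreeMonoid p).coeff w

/-- The number of letters of the word `w` that are `a` variables. -/
def wordDegA {ga gx : ℕ} (w : FreeMonoid (Fin ga ⊕ Fin gx)) : ℕ :=
  (FreeMonoid.toList w).countP Sum.isLeft

/-- The number of letters of the word `w` that are `x` variables. -/
def wordDegX {ga gx : ℕ} (w : FreeMonoid (Fin ga ⊕ Fin gx)) : ℕ :=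
  (FreeMonoid.toList w).countP Sum.isRight

/-- `p` has degree at most `d` in `a`. -/
def DegALE {ga gx : ℕ} (p : NCPoly ga gx) (d : ℕ) : Prop :=
  ∀ w, p.coeff w ≠ 0 → wordDegA w ≤ d

/-- `p` has degree at most `d` in `x`. -/
def DegXLE {ga gx : ℕ} (p : NCPoly ga gx) (d : ℕ) : Prop :=
  ∀ w, p.coeff w ≠ 0 → wordDegX w ≤ d

/-- `p` is a polynomial in the `a` variables only, homogeneous of degree one. -/
def IsLinearInAOnly {ga gx : ℕ} (p : NCPoly ga gx) : Prop :=
  ∀ w, p.coeff w ≠ 0 → wordDegA w = 1 ∧ wordDegX w = 0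

/-- `p` is a polynomial in the `x` variables only, homogeneous of degree one. -/
def IsLinearInXOnly {ga gx : ℕ} (p : NCPoly ga gx) : Prop :=
  ∀ w, p.coeff w ≠ 0 → wordDegA w = 0 ∧ wordDegX w = 1

/-- The value `p(A, X)` at tuples of `n × n` real matrices. -/
noncomputable def eval {ga gx n : ℕ} (p : NCPoly ga gx)
    (A : Fin ga → Matrix (Fin n) (Fin n) ℝ) (X : Fin gx → Matrix (Fin n) (Fin n) ℝ) :
    Matrix (Fin n) (Fin n) ℝ :=
  FreeAlgebra.lift ℝ (Sum.elim A X) p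

/-- Matrix convexity in `x`: `t p(A,X) + (1-t) p(A,Y) - p(A, tX + (1-t)Y)` is positive
semidefinite for all tuples of symmetric matrices of all sizes. -/
def ConvexInX {ga gx : ℕ} (p : NCPoly ga gx) : Prop :=
  ∀ (n : ℕ) (A : Fin ga → Matrix (Fin n) (Fin n) ℝ) (X Y : Fin gx → Matrix (Fin n) (Fin n) ℝ),
    (∀ i, (A i).IsSymm) → (∀ j, (X j).IsSymm) → (∀ j, (Y j).IsSymm) →
    ∀ t : ℝ, 0 < t → t < 1 →
      (t • p.eval A X + (1 - t) • p.eval A Y - p.eval A (t • X + (1 - t) • Y)).PosSemidef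

/-- Matrix concavity in `a`: `p(tA + (1-t)B, X) - (t p(A,X) + (1-t) p(B,X))` is positive
semidefinite for all tuples of symmetric matrices of all sizes. -/
def ConcaveInA {ga gx : ℕ} (p : NCPoly ga gx) : Prop :=
  ∀ (n : ℕ) (A B : Fin ga → Matrix (Fin n) (Fin n) ℝ) (X : Fin gx → Matrix (Fin n) (Fin n) ℝ),
    (∀ i, (A i).IsSymm) → (∀ i, (B i).IsSymm) → (∀ j, (X j).IsSymm) →
    ∀ t : ℝ, 0 < t → t < 1 →
      (p.eval (t • A + (1 - t) • B) X - (t • p.eval A X + (1 - t) • p.eval B X)).PosSemidef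

end NCPoly

/-! Convexity makes the second derivative of `p` in the `x` directions positive semidefinite, and
concavity does the same for `-p` in the `a` directions. Evaluate it at block diagonal matrices `Y ⊕
Z`, in an off-diagonal direction with corners `G i` and `(G i)ᵀ`, on a vector `(e, 0)`. Each
decomposition `u i m j v` of a word, with `i`, `j` differentiated, contributes the inner product of
`G i (u.reverse)(Y) e` with `m(Z) G j v(Y) e`. If the vectors `u(Y) e`, `u` short, are linearly
independent (truncated Fock space), the border vectors `G i u(Y) e` can be prescribed at will. So
the middle form alone is nonnegative for every symmetric `Z`: this is `MiddlePos`, obtained in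
`middlePos_of_secondDifference`.

A nonnegative form with a vanishing diagonal entry has a vanishing row
(`MiddlePos.coeff_eq_zero_of_diag`). At words of maximal degree this bounds the degree in `x` and in
`a` by two (`MiddlePos.countP_le_two`). Words `k j j k` mixing the two kinds get opposite signs from
the two hypotheses, hence vanish. Feeding this back into the row argument leaves, among words with
two letters of one kind, only those of length two (`MiddlePos.eq_pair_of_two_le_countP`). The
resulting quadratic parts are semidefinite and factor into squares; all the rest is `L`. -/

/-! ### Words in symmetric matrices acting on a vector. -/

open Matrix in
/-- The vector `u(Y) v`, where the word `u` is evaluated at the tuple of matrices `Y`. -/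
def wordMulVec {σ κ : Type*} [Fintype κ] (Y : σ → Matrix κ κ ℝ) (v : κ → ℝ) : List σ → κ → ℝ
  | [] => v
  | i :: w => Y i *ᵥ wordMulVec Y v w

open Matrix in
theorem wordMulVec_append {σ κ : Type*} [Fintype κ] (Y : σ → Matrix κ κ ℝ) (v : κ → ℝ)
    (u w : List σ) : wordMulVec Y v (u ++ w) = wordMulVec Y (wordMulVec Y v w) u := by
  induction u with
  | nil => rfl
  | cons i u ih => simp [wordMulVec, ih]

open Matrix in
theorem Matrix.IsSymm.dotProduct_mulVec_comm {κ : Type*} [Fintype κ] {M : Matrix κ κ ℝ}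
    (hM : M.IsSymm) (v w : κ → ℝ) : v ⬝ᵥ (M *ᵥ w) = (M *ᵥ v) ⬝ᵥ w := by
  rw [dotProduct_mulVec, ← mulVec_transpose, hM.eq]

open Matrix in
theorem dotProduct_wordMulVec {σ κ : Type*} [Fintype κ] {Y : σ → Matrix κ κ ℝ}
    (hY : ∀ i, (Y i).IsSymm) (v w : κ → ℝ) (u : List σ) :
    v ⬝ᵥ wordMulVec Y w u = wordMulVec Y v u.reverse ⬝ᵥ w := by
  induction u generalizing v with
  | nil => rfl
  | cons i u ih =>
    rw [wordMulVec, (hY i).dotProduct_mulVec_comm, ih, List.reverse_cons, wordMulVec_append]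
    rfl

/-! ### Truncated Fock space: matrices that separate short words. -/

section Fock

variable {σ : Type*}

/-- Words of length at most `N`. -/
abbrev ShortWord (σ : Type*) (N : ℕ) : Type _ := {w : List σ // w.length ≤ N}

open Classical in
/-- The sum of the creation and annihilation operators of the letter `i`,
on the span of the words of length at most `N`. -/
noncomputable def fockMatrix (N : ℕ) (i : σ) : Matrix (ShortWord σ N) (ShortWord σ N) ℝ :=
  fun u w => if u.1 = i :: w.1 ∨ w.1 = i :: u.1 then 1 else 0

theorem fockMatrix_isSymm (N : ℕ) (i : σ) : (fockMatrix N i).IsSymm := by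
  ext u w
  classical exact if_congr or_comm rfl rfl

open Classical in
/-- The vacuum vector. -/
noncomputable def vacuum (σ : Type*) (N : ℕ) : ShortWord σ N → ℝ :=
  fun u => if u.1 = [] then 1 else 0

-- Triangularity: applying `u` to the vacuum gives the basis vector `u` plus strictly shorter words,
-- since each annihilation loses length.
open Matrix Classical in
theorem wordMulVec_fock_of_le {N : ℕ} [Fintype (ShortWord σ N)] (u : List σ)
    (w : ShortWord σ N) (h : u.length ≤ w.1.length) :
    wordMulVec (fockMatrix N) (vacuum σ N) u w = if w.1 = u then 1 else 0 := by
  induction u generalizing w with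
  | nil => rfl
  | cons i u ih =>
    have h2 : ∀ w' : ShortWord σ N,
        fockMatrix N i w w' * wordMulVec (fockMatrix N) (vacuum σ N) u w' =
          if w'.1 = u ∧ w.1 = i :: u then 1 else 0 := by
      intro w'
      simp only [List.length_cons] at h
      by_cases h1 : w.1 = i :: w'.1
      · have : u.length ≤ w'.1.length := by
          have := congrArg List.length h1
          simp at this; omega
        rw [ih w' this]
        by_cases h3 : w'.1 = u
        · subst h3; simp [fockMatrix, h1]
        · simp [h3]
      -- The annihilation term: `w'` is longer than `u`, so its entry is zero by induction.
      · by_cases h4 : w'.1 = i :: w.1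
        · have hl : w'.1.length = w.1.length + 1 := by rw [h4]; simp
          have hne : w'.1 ≠ u := fun h => by rw [h] at hl; omega
          rw [ih w' (by omega)]
          simp [hne]
        · have : ¬ (w'.1 = u ∧ w.1 = i :: u) := by
            rintro ⟨rfl, h⟩; exact h1 h
          simp [fockMatrix, h1, h4, this]
    rw [wordMulVec, mulVec, dotProduct, Finset.sum_congr rfl fun w' _ => h2 w']
    by_cases hw : w.1 = i :: u
    · have hu : u.length ≤ N := by
        have := w.2; rw [hw] at this; simp at this; omega
      rw [Finset.sum_eq_single ⟨u, hu⟩]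
      · simp [hw]
      · intro b _ hb
        have : b.1 ≠ u := fun h => hb (Subtype.ext h)
        simp [this]
      · simp
    · simp [hw]

-- The triangular system is solved by induction on word length: the correction `δ` lives on words of
-- length `M` and so does not disturb the values at shorter words.
open Matrix Classical in
theorem exists_dual_fock {N : ℕ} [Fintype (ShortWord σ N)] (φ : List σ → ℝ) (M : ℕ) :
    ∃ β : ShortWord σ N → ℝ, ∀ u : List σ, u.length < M → u.length ≤ N →
      β ⬝ᵥ wordMulVec (fockMatrix N) (vacuum σ N) u = φ u := by
  induction M with
  | zero => exact ⟨0, by simp⟩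
  | succ M ih =>
    obtain ⟨β, hβ⟩ := ih
    let δ : ShortWord σ N → ℝ := fun w =>
      if w.1.length = M then φ w.1 - β ⬝ᵥ wordMulVec (fockMatrix N) (vacuum σ N) w.1 else 0
    refine ⟨β + δ, fun u hu hN => ?_⟩
    have key : ∀ w : ShortWord σ N, δ w * wordMulVec (fockMatrix N) (vacuum σ N) u w =
        if w = ⟨u, hN⟩ then δ w else 0 := by
      intro w
      by_cases hw : w.1.length = M
      · rw [wordMulVec_fock_of_le u w (by omega)]
        simp [Subtype.ext_iff]
      · simp [δ, hw]
    have hsum : δ ⬝ᵥ wordMulVec (fockMatrix N) (vacuum σ N) u = δ ⟨u, hN⟩ := by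
      rw [dotProduct, Finset.sum_congr rfl fun w _ => key w]
      simp
    rw [add_dotProduct, hsum]
    by_cases hM : u.length = M
    · simp [δ, hM]
    · rw [hβ u (by omega) hN]
      simp [δ, hM]

open Matrix in
/-- There are tuples of symmetric matrices with a vector `e` for which the vectors `u(Y) e`,
with `u` of length at most `N`, are linearly independent. -/
theorem exists_separating_matrices (σ : Type) [Finite σ] (N : ℕ) :
    ∃ (ι : Type) (_ : Fintype ι) (Y : σ → Matrix ι ι ℝ) (e : ι → ℝ),
      (∀ i, (Y i).IsSymm) ∧ ∀ φ : List σ → ℝ, ∃ β : ι → ℝ,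
        ∀ u : List σ, u.length ≤ N → β ⬝ᵥ wordMulVec Y e u = φ u := by
  have : Finite (ShortWord σ N) := List.finite_length_le σ N
  have := Fintype.ofFinite (ShortWord σ N)
  refine ⟨ShortWord σ N, this, fockMatrix N, vacuum σ N, fockMatrix_isSymm N, fun φ => ?_⟩
  obtain ⟨β, hβ⟩ := exists_dual_fock (N := N) φ (N + 1)
  exact ⟨β, fun u hu => hβ u (by omega) hu⟩

end Fock

/-! ### The middle form of the Hessian and its matrix entries. -/

section MiddleForm

variable {σ κ : Type*} [Fintype κ]

open Matrix in
/-- The sum of `u(Z) θ_{j,v}` over all decompositions `u j v` of a word. -/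
def borderVec (Z : σ → Matrix κ κ ℝ) (θ : σ → List σ → κ → ℝ) : List σ → κ → ℝ
  | [] => 0
  | i :: w => θ i w + Z i *ᵥ borderVec Z θ w

open Matrix in
/-- The sum of `⟪η_{i, u.reverse ++ acc}, m(Z) θ_{j,v}⟫` over all decompositions `u i m j v`
of a word. -/
def middleTerm (Z : σ → Matrix κ κ ℝ) (η θ : σ → List σ → κ → ℝ) :
    List σ → List σ → ℝ
  | _, [] => 0
  | acc, i :: w => η i acc ⬝ᵥ borderVec Z θ w + middleTerm Z η θ (i :: acc) w

theorem borderVec_add (Z : σ → Matrix κ κ ℝ) (θ θ' : σ → List σ → κ → ℝ) (w : List σ) :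
    borderVec Z (θ + θ') w = borderVec Z θ w + borderVec Z θ' w := by
  induction w with
  | nil => simp [borderVec]
  | cons i w ih => simp only [borderVec, ih, Matrix.mulVec_add, Pi.add_apply]; abel

theorem borderVec_smul (Z : σ → Matrix κ κ ℝ) (t : ℝ) (θ : σ → List σ → κ → ℝ) (w : List σ) :
    borderVec Z (t • θ) w = t • borderVec Z θ w := by
  induction w with
  | nil => simp [borderVec]
  | cons i w ih => simp only [borderVec, ih, Matrix.mulVec_smul, Pi.smul_apply, smul_add]

theorem middleTerm_add_smul (Z : σ → Matrix κ κ ℝ) (η θ : σ → List σ → κ → ℝ) (t : ℝ)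
    (acc w : List σ) :
    middleTerm Z (η + t • θ) (η + t • θ) acc w = middleTerm Z η η acc w +
      t * (middleTerm Z η θ acc w + middleTerm Z θ η acc w) +
      t ^ 2 * middleTerm Z θ θ acc w := by
  induction w generalizing acc with
  | nil => simp [middleTerm]
  | cons i w ih =>
    simp only [middleTerm, ih, borderVec_add, borderVec_smul, Pi.add_apply, Pi.smul_apply,
      add_dotProduct, dotProduct_add, smul_dotProduct, dotProduct_smul, smul_eq_mul]
    ring

open Classical in
/-- The border vector with the single nonzero entry `α` at `(j, u)`. -/
noncomputable def singleBorder (j : σ) (u : List σ) (α : κ → ℝ) : σ → List σ → κ → ℝ :=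
  fun i v => if i = j ∧ v = u then α else 0

theorem borderVec_single_eq_zero (Z : σ → Matrix κ κ ℝ) (j : σ) (u : List σ) (α : κ → ℝ)
    (w : List σ) (h : ∀ m, w ≠ m ++ j :: u) : borderVec Z (singleBorder j u α) w = 0 := by
  induction w with
  | nil => rfl
  | cons i w ih =>
    have h1 : ¬ (i = j ∧ w = u) := by
      rintro ⟨rfl, rfl⟩; exact h [] rfl
    rw [borderVec, ih fun m hm => h (i :: m) (by simp [hm])]
    simp [singleBorder, h1]

theorem borderVec_single (Z : σ → Matrix κ κ ℝ) (j : σ) (u : List σ) (α : κ → ℝ)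
    (m : List σ) : borderVec Z (singleBorder j u α) (m ++ j :: u) = wordMulVec Z α m := by
  induction m with
  | nil =>
    rw [List.nil_append, borderVec, borderVec_single_eq_zero]
    · simp [singleBorder, wordMulVec]
    · intro m hm
      have := congrArg List.length hm
      simp at this; omega
  | cons i m ih =>
    have h1 : ¬ (i = j ∧ m ++ j :: u = u) := by
      rintro ⟨-, h⟩
      have := congrArg List.length h
      simp at this; omega
    rw [List.cons_append, borderVec, ih]
    simp [singleBorder, h1, wordMulVec]

theorem middleTerm_single_left_eq_zero (Z : σ → Matrix κ κ ℝ) (i : σ) (r : List σ) (β : κ → ℝ)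
    (θ : σ → List σ → κ → ℝ) (acc w : List σ)
    (h : ∀ s w', w = s ++ i :: w' → s.reverse ++ acc ≠ r) :
    middleTerm Z (singleBorder i r β) θ acc w = 0 := by
  induction w generalizing acc with
  | nil => rfl
  | cons k w ih =>
    have h1 : ¬ (k = i ∧ acc = r) := by
      rintro ⟨rfl, rfl⟩; exact h [] w rfl rfl
    rw [middleTerm, ih]
    · simp [singleBorder, h1]
    · intro s w' hw
      have := h (k :: s) w' (by simp [hw])
      simpa using this

open Matrix in
theorem middleTerm_single_left (Z : σ → Matrix κ κ ℝ) (i : σ) (β : κ → ℝ)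
    (θ : σ → List σ → κ → ℝ) (acc s w : List σ) :
    middleTerm Z (singleBorder i (s.reverse ++ acc) β) θ acc (s ++ i :: w) =
      β ⬝ᵥ borderVec Z θ w := by
  induction s generalizing acc with
  | nil =>
    rw [List.nil_append, middleTerm, middleTerm_single_left_eq_zero]
    · simp [singleBorder]
    · intro s w' _ hs
      have := congrArg List.length hs
      simp at this; omega
  | cons k s ih =>
    have h1 : ¬ (k = i ∧ acc = (k :: s).reverse ++ acc) := by
      rintro ⟨-, h⟩
      have := congrArg List.length h
      simp at this; omega
    have h2 : (k :: s).reverse ++ acc = s.reverse ++ k :: acc := by simp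
    rw [List.cons_append, middleTerm, h2, ih]
    rw [h2] at h1
    simp [singleBorder, h1]

open Matrix in
theorem middleTerm_single (Z : σ → Matrix κ κ ℝ) (i j : σ) (s m u : List σ) (α β : κ → ℝ) :
    middleTerm Z (singleBorder i s.reverse β) (singleBorder j u α) []
      (s ++ i :: (m ++ j :: u)) = β ⬝ᵥ wordMulVec Z α m := by
  have := middleTerm_single_left Z i β (singleBorder j u α) [] s (m ++ j :: u)
  rwa [List.append_nil, borderVec_single] at this

theorem middleTerm_single_eq_zero (Z : σ → Matrix κ κ ℝ) (i j : σ) (s u : List σ) (α β : κ → ℝ)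
    (w : List σ) (h : ∀ m, w ≠ s ++ i :: (m ++ j :: u)) :
    middleTerm Z (singleBorder i s.reverse β) (singleBorder j u α) [] w = 0 := by
  by_cases hw : ∃ w', w = s ++ i :: w'
  · obtain ⟨w', rfl⟩ := hw
    have := middleTerm_single_left Z i β (singleBorder j u α) [] s w'
    rw [List.append_nil] at this
    rw [this, borderVec_single_eq_zero, dotProduct_zero]
    rintro m rfl
    exact h m rfl
  · refine middleTerm_single_left_eq_zero _ _ _ _ _ _ _ fun s' w' hs hr => hw ⟨w', ?_⟩
    rw [List.append_nil, List.reverse_inj] at hr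
    rw [hs, hr]

end MiddleForm

/-! ### Consequences of positivity of the middle form. -/

section MiddlePos

variable {σ : Type}

/-- The middle matrix of the Hessian, with respect to the letters in `S`, of the polynomial with
coefficients `c` is positive semidefinite at every tuple of symmetric matrices. -/
def MiddlePos (S : σ → Bool) (c : List σ → ℝ) (T : Finset (List σ)) : Prop :=
  ∀ (κ : Type) [Fintype κ] (Z : σ → Matrix κ κ ℝ) (η : σ → List σ → κ → ℝ),
    (∀ i, (Z i).IsSymm) → (∀ i u, S i = false → η i u = 0) →
    0 ≤ ∑ w ∈ T, c w * middleTerm Z η η [] w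

theorem eq_zero_of_forall_nonneg_add_mul {a b : ℝ} (h : ∀ t : ℝ, 0 ≤ a + t * b) : b = 0 := by
  by_contra hb
  have := h (-(a + 1) / b)
  rw [div_mul_cancel₀ _ hb] at this
  linarith

theorem nonneg_of_forall_quadratic_nonneg {a b c : ℝ} (h : ∀ t : ℝ, 0 ≤ a + t * b + t ^ 2 * c) :
    0 ≤ c := by
  by_contra! hc
  -- Large enough that `t ^ 2 * (-c)` exceeds `|a|`; adding the inequalities at `t` and `-t` cancels
  -- `b`.
  obtain ⟨t, ht⟩ : ∃ t : ℝ, t = 1 + |a| / (-c) := ⟨_, rfl⟩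
  have h0 : 0 ≤ |a| / (-c) := div_nonneg (abs_nonneg a) (by linarith)
  have ht1 : t * (-c) = -c + |a| := by
    rw [ht, add_mul, div_mul_cancel₀ _ (by linarith)]; ring
  have h1 := h t
  have h2 := h (-t)
  have h3 := le_abs_self a
  nlinarith [mul_nonneg (by linarith : (0 : ℝ) ≤ t - 1) (by linarith [abs_nonneg a] : 0 ≤ t * (-c))]

theorem Finset.sum_mul_eq_sum_comp {α β : Type*} [Fintype β] {T : Finset α} {c f : α → ℝ}
    (hT : ∀ w, c w ≠ 0 → w ∈ T) {g : β → α} (hg : Function.Injective g)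
    (hf : ∀ w, c w ≠ 0 → f w ≠ 0 → w ∈ Set.range g) :
    ∑ w ∈ T, c w * f w = ∑ x, c (g x) * f (g x) := by
  classical
  rw [← Finset.sum_image (s := Finset.univ) (g := g) (f := fun w => c w * f w)
    (fun _ _ _ _ h => hg h)]
  trans ∑ w ∈ T ∪ Finset.univ.image g, c w * f w
  · refine Finset.sum_subset Finset.subset_union_left fun w _ hw => ?_
    rw [not_imp_comm.1 (hT w) hw, zero_mul]
  · refine (Finset.sum_subset Finset.subset_union_right fun w _ hw => ?_).symm
    by_contra h
    obtain ⟨x, rfl⟩ := hf w (left_ne_zero_of_mul h) (right_ne_zero_of_mul h)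
    exact hw (Finset.mem_image_of_mem _ (Finset.mem_univ _))

section Vanishing

variable {S : σ → Bool} {c : List σ → ℝ} {T : Finset (List σ)}

-- In a nonnegative form, a zero diagonal entry at `(j, u₃)` forces the entries of its row to
-- vanish. Taking for `Z` the separating matrices themselves, with `β` dual to `u₂`, isolates one
-- coefficient of the off-diagonal entry.
open Matrix in
theorem MiddlePos.coeff_eq_zero_of_diag [Finite σ] (h : MiddlePos S c T)
    (hT : ∀ w, c w ≠ 0 → w ∈ T) (hrev : ∀ w, c w.reverse = c w) {i j : σ} (hi : S i = true)
    (hj : S j = true) (u₁ u₂ u₃ : List σ)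
    (hdiag : ∀ m, c (u₃.reverse ++ j :: (m ++ j :: u₃)) = 0) :
    c (u₁ ++ i :: (u₂ ++ j :: u₃)) = 0 := by
  classical
  by_contra hw₀
  obtain ⟨ι, _, Y, e, hY, hdual⟩ := exists_separating_matrices σ (T.sup List.length)
  obtain ⟨β, hβ⟩ := hdual fun u => if u = u₂ then 1 else 0
  have hlen : ∀ w ∈ T, w.length ≤ T.sup List.length := fun w hw => Finset.le_sup (f := List.length) hw
  let η := singleBorder i u₁.reverse β
  -- The double reversal lets `θ` also serve as left border, for the prefix `u₃.reverse`.
  let θ := singleBorder j u₃.reverse.reverse e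
  have h12 : ∑ w ∈ T, c w * middleTerm Y η θ [] w = c (u₁ ++ i :: (u₂ ++ j :: u₃)) := by
    have hmt : ∀ m, (u₁ ++ i :: (m ++ j :: u₃)) ∈ T →
        middleTerm Y η θ [] (u₁ ++ i :: (m ++ j :: u₃)) = if m = u₂ then 1 else 0 := by
      intro m hm
      have := hlen _ hm
      simp only [List.length_append, List.length_cons] at this
      rw [← hβ m (by omega), ← middleTerm_single Y i j u₁ m u₃ e β]
      simp [η, θ]
    rw [Finset.sum_eq_single (u₁ ++ i :: (u₂ ++ j :: u₃)), hmt _ (hT _ hw₀)]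
    · simp
    · intro w hw hne
      by_cases hm : ∃ m, w = u₁ ++ i :: (m ++ j :: u₃)
      · obtain ⟨m, rfl⟩ := hm
        rw [hmt m hw, if_neg, mul_zero]
        rintro rfl; exact hne rfl
      · simp only [η, θ, List.reverse_reverse]
        rw [middleTerm_single_eq_zero, mul_zero]
        exact not_exists.1 hm
    · intro hn; exact absurd (hT _ hw₀) hn
  have h21 : ∑ w ∈ T, c w * middleTerm Y θ η [] w = c (u₁ ++ i :: (u₂ ++ j :: u₃)) := by
    have hmt : ∀ m, (u₃.reverse ++ j :: (m ++ i :: u₁.reverse)) ∈ T →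
        middleTerm Y θ η [] (u₃.reverse ++ j :: (m ++ i :: u₁.reverse)) =
          if m.reverse = u₂ then 1 else 0 := by
      intro m hm
      have := hlen _ hm
      simp only [List.length_append, List.length_cons] at this
      rw [← hβ m.reverse (by simp; omega), dotProduct_comm, ← dotProduct_wordMulVec hY,
        ← middleTerm_single Y j i u₃.reverse m u₁.reverse β e]
    have hw₁ : (u₁ ++ i :: (u₂ ++ j :: u₃)).reverse =
        u₃.reverse ++ j :: (u₂.reverse ++ i :: u₁.reverse) := by simp
    have hc := hrev (u₁ ++ i :: (u₂ ++ j :: u₃))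
    rw [hw₁] at hc
    rw [Finset.sum_eq_single (u₃.reverse ++ j :: (u₂.reverse ++ i :: u₁.reverse)),
      hmt _ (hT _ (hc ▸ hw₀)), hc]
    · simp
    · intro w hw hne
      by_cases hm : ∃ m, w = u₃.reverse ++ j :: (m ++ i :: u₁.reverse)
      · obtain ⟨m, rfl⟩ := hm
        rw [hmt m hw, if_neg, mul_zero]
        rintro rfl; exact hne (by simp)
      · rw [middleTerm_single_eq_zero, mul_zero]
        exact not_exists.1 hm
    · intro hn; exact absurd (hT _ (hc ▸ hw₀)) hn
  have h22 : ∑ w ∈ T, c w * middleTerm Y θ θ [] w = 0 := by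
    refine Finset.sum_eq_zero fun w _ => ?_
    by_cases hm : ∃ m, w = u₃.reverse ++ j :: (m ++ j :: u₃)
    · obtain ⟨m, rfl⟩ := hm
      rw [hdiag, zero_mul]
    · have := middleTerm_single_eq_zero Y j j u₃.reverse u₃ e e w (not_exists.1 hm)
      simp only [List.reverse_reverse] at this
      simp only [θ, List.reverse_reverse, this, mul_zero]
  -- The form at `η + t • θ` has no `t ^ 2` term, and both cross terms give the same coefficient, by
  -- reversal symmetry.
  have hpos : ∀ t : ℝ, 0 ≤ ∑ w ∈ T, c w * middleTerm Y η η [] w +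
      t * (2 * c (u₁ ++ i :: (u₂ ++ j :: u₃))) := by
    intro t
    have h0 := h ι Y (η + t • θ) hY (by
      intro k u hk
      have hki : k ≠ i := by rintro rfl; simp [hi] at hk
      have hkj : k ≠ j := by rintro rfl; simp [hj] at hk
      simp [η, θ, singleBorder, hki, hkj])
    have h1 : ∑ w ∈ T, c w * middleTerm Y (η + t • θ) (η + t • θ) [] w =
        ∑ w ∈ T, c w * middleTerm Y η η [] w +
        t * (∑ w ∈ T, c w * middleTerm Y η θ [] w + ∑ w ∈ T, c w * middleTerm Y θ η [] w) +
        t ^ 2 * ∑ w ∈ T, c w * middleTerm Y θ θ [] w := by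
      simp only [Finset.mul_sum, ← Finset.sum_add_distrib]
      refine Finset.sum_congr rfl fun w _ => ?_
      rw [middleTerm_add_smul]; ring
    rw [h1, h12, h21, h22] at h0
    linarith
  have := eq_zero_of_forall_nonneg_add_mul hpos
  exact hw₀ (by linarith)

theorem wordMulVec_zero {κ : Type*} [Fintype κ] (α : κ → ℝ) (m : List σ) (hm : m ≠ []) :
    wordMulVec (0 : σ → Matrix κ κ ℝ) α m = 0 := by
  cases m with
  | nil => exact absurd rfl hm
  | cons i m => simp [wordMulVec]

/-- At `Z = 0` only empty middle words survive, and a single scalar border entry then selects one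
word. -/
theorem MiddlePos.coeff_diag_nonneg (h : MiddlePos S c T) (hT : ∀ w, c w ≠ 0 → w ∈ T) {j : σ}
    (hj : S j = true) (u : List σ) : 0 ≤ c (u ++ j :: j :: u.reverse) := by
  let η : σ → List σ → Unit → ℝ := singleBorder j u.reverse 1
  have h0 := h Unit 0 η (fun _ => Matrix.isSymm_zero) (by
    intro k u hk
    have hkj : k ≠ j := by rintro rfl; simp [hj] at hk
    simp [η, singleBorder, hkj])
  rw [Finset.sum_mul_eq_sum_comp hT (g := fun _ : Unit => u ++ j :: j :: u.reverse)
    (fun _ _ _ => rfl)] at h0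
  · have := middleTerm_single (0 : σ → Matrix Unit Unit ℝ) j j u [] u.reverse 1 1
    simp only [List.nil_append] at this
    simpa [η, this, wordMulVec] using h0
  · intro w _ hw
    by_contra hne
    apply hw
    by_cases hm : ∃ m, w = u ++ j :: (m ++ j :: u.reverse)
    · obtain ⟨m, rfl⟩ := hm
      rw [middleTerm_single, wordMulVec_zero, dotProduct_zero]
      rintro rfl; exact hne ⟨(), by simp⟩
    · exact middleTerm_single_eq_zero _ _ _ _ _ _ _ _ (not_exists.1 hm)

/-- The border vector with the entries `α i` at `(i, [])`. -/
def linearBorder (α : σ → ℝ) : σ → List σ → Unit → ℝ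
  | i, [] => fun _ => α i
  | _, _ :: _ => 0

theorem middleTerm_linearBorder_cons (Z : σ → Matrix Unit Unit ℝ) (α : σ → ℝ)
    (θ : σ → List σ → Unit → ℝ) (k : σ) (acc w : List σ) :
    middleTerm Z (linearBorder α) θ (k :: acc) w = 0 := by
  induction w generalizing k acc with
  | nil => rfl
  | cons i w ih => simp [middleTerm, ih, linearBorder]

open Classical in
/-- The scalar tuple with the value `z` at the letter `k` and zero elsewhere. -/
noncomputable def scalarAt (k : σ) (z : ℝ) : σ → Matrix Unit Unit ℝ :=
  fun l => if l = k then z • 1 else 0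

theorem borderVec_linearBorder (k : σ) (z : ℝ) (α : σ → ℝ) (n : ℕ) (j : σ) :
    borderVec (scalarAt k z) (linearBorder α) (List.replicate n k ++ [j]) =
      fun _ => z ^ n * α j := by
  induction n with
  | zero => simp [borderVec, linearBorder]
  | succ n ih =>
    have : ∀ l, ∀ w ≠ [], linearBorder α l w = 0 := by
      intro l w hw
      cases w with
      | nil => exact absurd rfl hw
      | cons => rfl
    rw [List.replicate_succ, List.cons_append, borderVec, ih, this _ _ (by simp)]
    ext
    simp [scalarAt, Matrix.smul_mulVec]
    ring

theorem exists_of_borderVec_linearBorder_ne_zero {k : σ} {z : ℝ} {α : σ → ℝ} {w : List σ}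
    (h : borderVec (scalarAt k z) (linearBorder α) w ≠ 0) :
    ∃ n j, w = List.replicate n k ++ [j] := by
  induction w with
  | nil => exact absurd rfl h
  | cons i w ih =>
    cases w with
    | nil => exact ⟨0, i, rfl⟩
    | cons l w =>
      have h1 : borderVec (scalarAt k z) (linearBorder α) (i :: l :: w) =
        Matrix.mulVec (scalarAt k z i)
          (borderVec (scalarAt k z) (linearBorder α) (l :: w)) := by
        rw [borderVec]; simp [linearBorder]
      rw [h1] at h
      have hi : i = k := by
        by_contra hne
        simp [scalarAt, hne] at h
      obtain ⟨n, j, hw⟩ := ih fun h0 => h (by rw [h0, Matrix.mulVec_zero])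
      exact ⟨n + 1, j, by rw [hw, hi, List.replicate_succ, List.cons_append]⟩

/-- With scalar `Z` supported at `k` and borders only at the empty word, just the words `i k ⋯ k j`
contribute; `hk` cuts the resulting polynomial in `z` down to degree two. -/
theorem MiddlePos.linear_nonneg [Fintype σ] (h : MiddlePos S c T) (hT : ∀ w, c w ≠ 0 → w ∈ T)
    (k : σ) (hk : ∀ i j n, 3 ≤ n → c (i :: (List.replicate n k ++ [j])) = 0)
    (α : σ → ℝ) (hα : ∀ i, S i = false → α i = 0) (z : ℝ) :
    0 ≤ ∑ i, ∑ j, α i * α j * c [i, j] + z * (∑ i, ∑ j, α i * α j * c [i, k, j]) +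
      z ^ 2 * ∑ i, ∑ j, α i * α j * c [i, k, k, j] := by
  have h0 := h Unit (scalarAt k z) (linearBorder α) (by
    intro l
    ext
    simp) (by
    intro i u hi
    cases u with
    | nil => ext; simp [linearBorder, hα i hi]
    | cons => rfl)
  have hval : ∀ i w, middleTerm (scalarAt k z) (linearBorder α) (linearBorder α) [] (i :: w) =
      α i * borderVec (scalarAt k z) (linearBorder α) w () := by
    intro i w
    rw [middleTerm, middleTerm_linearBorder_cons]
    simp [linearBorder, dotProduct]
  rw [Finset.sum_mul_eq_sum_comp hT
    (g := fun x : σ × σ × Fin 3 => x.1 :: (List.replicate x.2.2 k ++ [x.2.1]))] at h0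
  · simp only [hval, borderVec_linearBorder, Fintype.sum_prod_type, Fin.sum_univ_three,
      Finset.mul_sum, ← Finset.sum_add_distrib] at h0 ⊢
    refine h0.trans_eq (Finset.sum_congr rfl fun i _ => Finset.sum_congr rfl fun j _ => ?_)
    change c [i, j] * (α i * (z ^ 0 * α j)) + c [i, k, j] * (α i * (z ^ 1 * α j)) +
      c [i, k, k, j] * (α i * (z ^ 2 * α j)) = _
    ring
  · rintro ⟨i, j, n⟩ ⟨i', j', n'⟩ hx
    simp only [List.cons.injEq] at hx
    have h1 := congrArg List.length hx.2
    simp at h1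
    have h2 : n = n' := Fin.ext h1
    subst h2
    simpa using hx
  · intro w hc hw
    cases w with
    | nil => exact absurd rfl hw
    | cons i w =>
      rw [hval] at hw
      obtain ⟨n, j, rfl⟩ := exists_of_borderVec_linearBorder_ne_zero
        (fun h0 => right_ne_zero_of_mul hw (by rw [h0]; rfl))
      have hn : n < 3 := by
        by_contra! hn
        exact hc (hk i j n hn)
      exact ⟨(i, j, ⟨n, hn⟩), rfl⟩

end Vanishing

end MiddlePos

/-! ### Which words can occur under opposite signs in the two kinds of letters. -/

section Classification

variable {σ : Type}

theorem List.exists_eq_append_of_countP_eq_succ (S : σ → Bool) (n : ℕ) (w : List σ)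
    (h : w.countP S = n + 1) :
    ∃ u i v, w = u ++ i :: v ∧ S i = true ∧ u.countP S = 0 ∧ v.countP S = n := by
  induction w with
  | nil => simp at h
  | cons k w ih =>
    by_cases hk : S k = true
    · exact ⟨[], k, w, rfl, hk, rfl, by simpa [List.countP_cons, hk] using h⟩
    · obtain ⟨u, i, v, rfl, hi, hu, hv⟩ := ih (by simpa [List.countP_cons, hk] using h)
      exact ⟨k :: u, i, v, rfl, hi, by simp [hk, hu], hv⟩

theorem List.countP_add_countP_not (S : σ → Bool) (w : List σ) :
    w.countP S + w.countP (fun i => !S i) = w.length := by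
  rw [List.length_eq_countP_add_countP S]
  simp

variable {S : σ → Bool} {c : List σ → ℝ} {T : Finset (List σ)}

/-- Split a word of maximal degree, at least three, at its first two letters in `S`. The
corresponding diagonal words contain the remainder twice, so they have larger degree and vanish. -/
theorem MiddlePos.countP_le_two [Finite σ] (h : MiddlePos S c T) (hT : ∀ w, c w ≠ 0 → w ∈ T)
    (hrev : ∀ w, c w.reverse = c w) (w : List σ) (hw : c w ≠ 0) : w.countP S ≤ 2 := by
  obtain ⟨w₀, hw₀, hmax⟩ := Finset.exists_max_image (T.filter fun w => c w ≠ 0) (List.countP S)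
    ⟨w, Finset.mem_filter.2 ⟨hT w hw, hw⟩⟩
  have hmax' : ∀ w, c w ≠ 0 → w.countP S ≤ w₀.countP S :=
    fun w hw => hmax w (Finset.mem_filter.2 ⟨hT w hw, hw⟩)
  refine (hmax' w hw).trans ?_
  by_contra! h3
  obtain ⟨n, hn⟩ : ∃ n, w₀.countP S = n + 1 + 1 + 1 := ⟨w₀.countP S - 3, by omega⟩
  obtain ⟨u₁, i, v, rfl, hi, -, hv⟩ := List.exists_eq_append_of_countP_eq_succ S _ w₀ hn
  obtain ⟨u₂, j, u₃, rfl, hj, -, hu₃⟩ := List.exists_eq_append_of_countP_eq_succ S _ v hv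
  refine (Finset.mem_filter.1 hw₀).2
    (h.coeff_eq_zero_of_diag hT hrev hi hj u₁ u₂ u₃ fun m => ?_)
  by_contra hm
  have := hmax' _ hm
  rw [hn] at this
  simp [hj, hu₃] at this
  omega

theorem List.le_countP_append_replicate {i j k : σ} (hk : S k = true) (n : ℕ) :
    n ≤ (i :: (List.replicate n k ++ [j])).countP S := by
  simp [List.countP_cons, List.countP_replicate, hk]
  omega

variable [Fintype σ]

/-- Positivity in `S` makes this coefficient nonnegative, as a diagonal entry. Negativity in the
other letters makes it nonpositive, as the leading coefficient of a polynomial in the value of `j`.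
-/
theorem MiddlePos.coeff_cross_eq_zero (h : MiddlePos S c T)
    (h' : MiddlePos (fun i => !S i) (-c) T) (hT : ∀ w, c w ≠ 0 → w ∈ T)
    (hrev : ∀ w, c w.reverse = c w) {j k : σ} (hj : S j = true) (hk : S k = false) :
    c [k, j, j, k] = 0 := by
  classical
  have h1 : 0 ≤ c [k, j, j, k] := h.coeff_diag_nonneg hT hj [k]
  have hα : ∀ z : ℝ, 0 ≤ -c [k, k] + z * -c [k, j, k] + z ^ 2 * -c [k, j, j, k] := by
    intro z
    have := h'.linear_nonneg (fun w hw => hT w (by simpa using hw)) j (fun i l n hn => by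
      by_contra hne
      have h2 := h.countP_le_two hT hrev _ (neg_ne_zero.1 hne)
      have h3 := List.le_countP_append_replicate (i := i) (j := l) hj n
      omega) (Pi.single k 1) (fun i hi => by
        rw [Pi.single_apply, if_neg]
        rintro rfl
        simp [hk] at hi) z
    simpa [Pi.single_apply] using this
  have h2 := nonneg_of_forall_quadratic_nonneg hα
  linarith

/-- By the degree bounds in both kinds of letters, the only diagonal word `u₃.reverse j m j u₃` that
could occur is `k j j k`, with `k` outside `S`; it vanishes too, so the row vanishes. -/
theorem MiddlePos.coeff_eq_zero_of_right_ne_nil (h : MiddlePos S c T)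
    (h' : MiddlePos (fun i => !S i) (-c) T) (hT : ∀ w, c w ≠ 0 → w ∈ T)
    (hrev : ∀ w, c w.reverse = c w) {i j : σ} (hi : S i = true) (hj : S j = true)
    (u₁ u₂ u₃ : List σ) (h3 : u₃ ≠ []) : c (u₁ ++ i :: (u₂ ++ j :: u₃)) = 0 := by
  by_contra hw
  have hS := h.countP_le_two hT hrev
  have hS' : ∀ w, c w ≠ 0 → w.countP (fun i => !S i) ≤ 2 := fun w hw =>
    h'.countP_le_two (fun w hw => hT w (by simpa using hw)) (by simpa using hrev) w (by simpa using hw)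
  refine hw (h.coeff_eq_zero_of_diag hT hrev hi hj u₁ u₂ u₃ fun m => ?_)
  by_contra hm
  have h1 := hS _ hw
  have h2 := hS _ hm
  have h4 := hS' _ hm
  have h5 := List.countP_add_countP_not S u₃
  have h6 := List.countP_add_countP_not S m
  have h7 := List.length_pos_iff.2 h3
  simp [hi, hj] at h1 h2 h4
  have hm0 : m = [] := List.length_eq_zero_iff.1 (by omega)
  obtain ⟨k, rfl⟩ := List.length_eq_one_iff.1 (by omega : u₃.length = 1)
  subst hm0
  refine hm (h.coeff_cross_eq_zero h' hT hrev hj ?_)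
  by_contra hk
  rw [Bool.not_eq_false] at hk
  simp [hk] at h1
  omega

/-- The words `i k k j` vanish by the preceding lemma for the complementary letters. What remains is
affine in the value of `k` and nonnegative on all of `ℝ`, so its slope is zero. -/
theorem MiddlePos.coeff_three_eq_zero (h : MiddlePos S c T)
    (h' : MiddlePos (fun i => !S i) (-c) T) (hT : ∀ w, c w ≠ 0 → w ∈ T)
    (hrev : ∀ w, c w.reverse = c w) {i j k : σ} (hi : S i = true) (hj : S j = true)
    (hk : S k = false) : c [i, k, j] = 0 := by
  classical
  have hT' : ∀ w, (-c) w ≠ 0 → w ∈ T := fun w hw => hT w (by simpa using hw)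
  have hrev' : ∀ w, (-c) w.reverse = (-c) w := by simpa using hrev
  have h2 : ∀ i j, c [i, k, k, j] = 0 := by
    intro i j
    have := h'.coeff_eq_zero_of_right_ne_nil (by simpa using h) hT' hrev' (i := k) (j := k)
      (by simp [hk]) (by simp [hk]) [i] [] [j] (by simp)
    simpa using this
  have key : ∀ α : σ → ℝ, (∀ i, S i = false → α i = 0) →
      ∑ i, ∑ j, α i * α j * c [i, k, j] = 0 := by
    intro α hα
    refine eq_zero_of_forall_nonneg_add_mul (a := ∑ i, ∑ j, α i * α j * c [i, j]) fun z => ?_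
    have := h.linear_nonneg hT k (fun i j n hn => by
      by_contra hne
      have h3 := h'.countP_le_two hT' hrev' _ (by simpa using hne)
      have h4 := List.le_countP_append_replicate (S := fun i => !S i) (i := i) (j := j)
        (by simpa using hk) n
      omega) α hα z
    simpa [h2] using this
  have hsupp : ∀ i, S i = true → ∀ l, S l = false → (Pi.single i 1 : σ → ℝ) l = 0 := by
    intro i hi l hl
    rw [Pi.single_apply, if_neg]
    rintro rfl
    simp [hi] at hl
  -- Polarization, using that the form is symmetric (`h6`).
  have h3 := key (Pi.single i 1) (hsupp i hi)
  have h4 := key (Pi.single j 1) (hsupp j hj)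
  have h5 := key (Pi.single i 1 + Pi.single j 1) (fun l hl => by
    simp [hsupp i hi l hl, hsupp j hj l hl])
  have h6 : c [j, k, i] = c [i, k, j] := by simpa using hrev [i, k, j]
  simp only [Pi.add_apply, add_mul, mul_add, Finset.sum_add_distrib] at h5
  simp [Pi.single_apply] at h3 h4 h5
  linarith

/-- If the Hessian in the letters of `S` is positive and the Hessian in the remaining letters is
negative, then the only words of degree at least two in `S` have length two. -/
theorem MiddlePos.eq_pair_of_two_le_countP (h : MiddlePos S c T)
    (h' : MiddlePos (fun i => !S i) (-c) T) (hT : ∀ w, c w ≠ 0 → w ∈ T)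
    (hrev : ∀ w, c w.reverse = c w) (w : List σ) (hw : c w ≠ 0) (h2 : 2 ≤ w.countP S) :
    ∃ i j, S i = true ∧ S j = true ∧ w = [i, j] := by
  have hT' : ∀ w, (-c) w ≠ 0 → w ∈ T := fun w hw => hT w (by simpa using hw)
  have hrev' : ∀ w, (-c) w.reverse = (-c) w := by simpa using hrev
  have hle := h.countP_le_two hT hrev w hw
  obtain ⟨u₁, i, v, rfl, hi, -, hv⟩ :=
    List.exists_eq_append_of_countP_eq_succ S 1 w (by omega)
  obtain ⟨u₂, j, u₃, rfl, hj, hu₂, -⟩ := List.exists_eq_append_of_countP_eq_succ S 0 v hv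
  have h3 : u₃ = [] := by
    by_contra h3
    exact hw (h.coeff_eq_zero_of_right_ne_nil h' hT hrev hi hj u₁ u₂ u₃ h3)
  have h1 : u₁ = [] := by
    by_contra h1
    refine hw ?_
    rw [← hrev]
    have := h.coeff_eq_zero_of_right_ne_nil h' hT hrev hj hi u₃.reverse u₂.reverse u₁.reverse
      (by simpa using h1)
    simpa using this
  subst h1 h3
  have hle' := h'.countP_le_two hT' hrev' _ (by simpa using hw)
  have h4 := List.countP_add_countP_not S u₂
  simp [hi, hj] at hle'
  -- `u₂` has no letter in `S`, and at most two letters outside it.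
  match u₂, hu₂, hle', h4, hw with
  | [], _, _, _, _ => exact ⟨i, j, hi, hj, rfl⟩
  | [k], hu₂, _, _, hw =>
    exact absurd (h.coeff_three_eq_zero h' hT hrev hi hj (by simpa using hu₂)) hw
  | [k, l], hu₂, _, _, hw =>
    simp at hu₂
    have := h'.coeff_eq_zero_of_right_ne_nil (by simpa using h) hT' hrev' (i := k) (j := l)
      (by simp [hu₂]) (by simp [hu₂]) [i] [] [j] (by simp)
    exact absurd (by simpa using this) hw
  | _ :: _ :: _ :: _, hu₂, hle', h4, _ =>
    simp only [List.length_cons, hu₂] at h4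
    omega

theorem MiddlePos.pair_nonneg (h : MiddlePos S c T) (h' : MiddlePos (fun i => !S i) (-c) T)
    (hT : ∀ w, c w ≠ 0 → w ∈ T) (hrev : ∀ w, c w.reverse = c w)
    (α : σ → ℝ) (hα : ∀ i, S i = false → α i = 0) :
    0 ≤ ∑ i, ∑ j, α i * α j * c [i, j] := by
  -- At `z = 0` the letter `k` plays no role except to bound the runs of `k`; the bound comes from
  -- `h'` or `h` according to the kind of `k`.
  by_cases hS : ∃ k, S k = false
  · obtain ⟨k, hk⟩ := hS
    have := h.linear_nonneg hT k (fun i j n hn => by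
      by_contra hne
      have h3 := h'.countP_le_two (fun w hw => hT w (by simpa using hw)) (by simpa using hrev) _
        (by simpa using hne)
      have h4 := List.le_countP_append_replicate (S := fun i => !S i) (i := i) (j := j)
        (by simpa using hk) n
      omega) α hα 0
    simpa using this
  · push Not at hS
    rcases isEmpty_or_nonempty σ with _ | ⟨⟨k⟩⟩
    · simp
    · have := h.linear_nonneg hT k (fun i j n hn => by
        by_contra hne
        have h3 := h.countP_le_two hT hrev _ hne
        have h4 := List.le_countP_append_replicate (i := i) (j := j)
          (by simpa using hS k : S k = true) n
        omega) α hα 0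
      simpa using this

end Classification

/-! ### From second differences to the middle form. -/

section Hessian

open Matrix

variable {σ : Type}

/-- The first derivative at `Y` in the direction `H` of `u(Y) v`. -/
def wordDeriv {κ : Type*} [Fintype κ] (Y H : σ → Matrix κ κ ℝ) (v : κ → ℝ) : List σ → κ → ℝ
  | [] => 0
  | i :: w => H i *ᵥ wordMulVec Y v w + Y i *ᵥ wordDeriv Y H v w

/-- Half the second derivative at `Y` in the direction `H` of `u(Y) v`. -/
def wordHess {κ : Type*} [Fintype κ] (Y H : σ → Matrix κ κ ℝ) (v : κ → ℝ) : List σ → κ → ℝ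
  | [] => 0
  | i :: w => H i *ᵥ wordDeriv Y H v w + Y i *ᵥ wordHess Y H v w

/-- The remainder of the second order expansion of `u(Y + s H) v`. -/
def wordRem {κ : Type*} [Fintype κ] (Y H : σ → Matrix κ κ ℝ) (v : κ → ℝ) (s : ℝ) :
    List σ → κ → ℝ
  | [] => 0
  | i :: w => H i *ᵥ wordHess Y H v w + (Y i + s • H i) *ᵥ wordRem Y H v s w

theorem wordMulVec_add_smul {κ : Type*} [Fintype κ] (Y H : σ → Matrix κ κ ℝ) (v : κ → ℝ) (s : ℝ)
    (w : List σ) : wordMulVec (Y + s • H) v w = wordMulVec Y v w + s • wordDeriv Y H v w +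
      s ^ 2 • wordHess Y H v w + s ^ 3 • wordRem Y H v s w := by
  induction w with
  | nil => simp [wordMulVec, wordDeriv, wordHess, wordRem]
  | cons i w ih =>
    simp only [wordMulVec, wordDeriv, wordHess, wordRem, ih, Pi.add_apply, Pi.smul_apply,
      add_mulVec, mulVec_add, mulVec_smul, smul_mulVec, smul_add, smul_smul]
    module

theorem continuous_wordRem {κ : Type*} [Fintype κ] (Y H : σ → Matrix κ κ ℝ) (v : κ → ℝ)
    (w : List σ) : Continuous fun s => wordRem Y H v s w := by
  induction w with
  | nil => exact continuous_const
  | cons i w ih =>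
    simp only [wordRem]
    fun_prop

/-- Positivity of the second difference implies positivity of the Hessian. -/
theorem sum_wordHess_nonneg {κ : Type*} [Fintype κ] (c : List σ → ℝ) (T : Finset (List σ))
    (Y H : σ → Matrix κ κ ℝ) (v : κ → ℝ)
    (h : ∀ s : ℝ, 0 ≤ ∑ w ∈ T, c w * (v ⬝ᵥ (wordMulVec (Y + s • H) v w +
      wordMulVec (Y + (-s) • H) v w - (2 : ℝ) • wordMulVec Y v w))) :
    0 ≤ ∑ w ∈ T, c w * (v ⬝ᵥ wordHess Y H v w) := by
  let r : ℝ → ℝ := fun s =>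
    2 * ∑ w ∈ T, c w * (v ⬝ᵥ wordHess Y H v w) +
      s * ∑ w ∈ T, c w * (v ⬝ᵥ (wordRem Y H v s w - wordRem Y H v (-s) w))
  have hr : Continuous r := by
    have := continuous_wordRem Y H v
    have h2 : ∀ w, Continuous fun s => wordRem Y H v (-s) w := fun w => (this w).comp continuous_neg
    have h3 : ∀ w, Continuous fun s =>
        v ⬝ᵥ (wordRem Y H v s w - wordRem Y H v (-s) w) := fun w =>
      continuous_const.dotProduct ((this w).sub (h2 w))
    fun_prop
  have hpos : ∀ s : ℝ, 0 < s → 0 ≤ r s := by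
    intro s hs
    -- Odd-order terms below the remainder cancel, so the second difference is divisible by `s ^ 2`;
    -- then `s` tends to zero from the right.
    have h1 : ∑ w ∈ T, c w * (v ⬝ᵥ (wordMulVec (Y + s • H) v w +
        wordMulVec (Y + (-s) • H) v w - (2 : ℝ) • wordMulVec Y v w)) = s ^ 2 * r s := by
      simp only [r, mul_add, Finset.mul_sum, ← Finset.sum_add_distrib]
      refine Finset.sum_congr rfl fun w _ => ?_
      simp only [wordMulVec_add_smul, dotProduct_add, dotProduct_sub, dotProduct_smul, smul_eq_mul]
      ring
    have h2 := h s
    rw [h1] at h2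
    exact nonneg_of_mul_nonneg_right h2 (by positivity)
  have h0 : 0 ≤ r 0 := by
    refine ge_of_tendsto (hr.tendsto 0 |>.mono_left (nhdsWithin_le_nhds (s := Set.Ioi 0))) ?_
    filter_upwards [self_mem_nhdsWithin] with s hs using hpos s hs
  simp only [r, zero_mul, add_zero] at h0
  linarith

theorem wordMulVec_submatrix {κ ι : Type*} [Fintype κ] [Fintype ι] (e : κ ≃ ι)
    (Y : σ → Matrix ι ι ℝ) (v : ι → ℝ) (w : List σ) :
    wordMulVec (fun i => (Y i).submatrix e e) (v ∘ e) w = wordMulVec Y v w ∘ e := by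
  induction w with
  | nil => rfl
  | cons i w ih =>
    rw [wordMulVec, ih, wordMulVec, submatrix_mulVec_equiv]
    simp [Function.comp_assoc]

variable {S : σ → Bool} {c : List σ → ℝ} {T : Finset (List σ)}

section Block

variable {ι κ : Type*} [Fintype ι] [Fintype κ] (Y : σ → Matrix ι ι ℝ) (Z : σ → Matrix κ κ ℝ)
  (G : σ → Matrix κ ι ℝ) (e : ι → ℝ) (η : σ → List σ → κ → ℝ)

theorem wordMulVec_blockDiagonal (w : List σ) :
    wordMulVec (fun i => fromBlocks (Y i) 0 0 (Z i)) (Sum.elim e 0) w =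
      Sum.elim (wordMulVec Y e w) 0 := by
  induction w with
  | nil => rfl
  | cons i w ih => simp [wordMulVec, ih, fromBlocks_mulVec]

theorem wordDeriv_block (N : ℕ)
    (hG : ∀ i u, u.length ≤ N → G i *ᵥ wordMulVec Y e u = η i u) (w : List σ)
    (hw : w.length ≤ N) :
    wordDeriv (fun i => fromBlocks (Y i) 0 0 (Z i)) (fun i => fromBlocks 0 (G i)ᵀ (G i) 0)
      (Sum.elim e 0) w = Sum.elim (0 : ι → ℝ) (borderVec Z η w) := by
  induction w with
  | nil => simp [wordDeriv, borderVec]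
  | cons i w ih =>
    simp only [List.length_cons] at hw
    rw [wordDeriv, ih (by omega), wordMulVec_blockDiagonal]
    simp [borderVec, fromBlocks_mulVec, hG i w (by omega), ← Sum.elim_add_add]

/-- The off-diagonal direction swaps the two blocks: the letters outside the two differentiated ones
act through `Y`, those between them through `Z`. Symmetry moves the leading letters onto the left
vector, where `acc` records them. -/
theorem dotProduct_wordHess_block (hY : ∀ i, (Y i).IsSymm) (N : ℕ)
    (hG : ∀ i u, u.length ≤ N → G i *ᵥ wordMulVec Y e u = η i u) (acc w : List σ)
    (hw : acc.length + w.length ≤ N) :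
    Sum.elim (wordMulVec Y e acc) 0 ⬝ᵥ wordHess (fun i => fromBlocks (Y i) 0 0 (Z i))
      (fun i => fromBlocks 0 (G i)ᵀ (G i) 0) (Sum.elim e 0) w = middleTerm Z η η acc w := by
  induction w generalizing acc with
  | nil => simp [wordHess, middleTerm]
  | cons i w ih =>
    simp only [List.length_cons] at hw
    have h1 := ih (i :: acc) (by simp only [List.length_cons]; omega)
    rw [wordHess, middleTerm, wordDeriv_block Y Z G e η N hG w (by omega), dotProduct_add, ← h1]
    congr 1
    · rw [← hG i acc (by omega), dotProduct_comm (G i *ᵥ _), dotProduct_mulVec (borderVec Z η w),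
        fromBlocks_mulVec]
      simp [mulVec_transpose, dotProduct_comm]
    · rw [dotProduct_mulVec, ← mulVec_transpose, fromBlocks_transpose, fromBlocks_mulVec]
      simp [wordMulVec, (hY i).eq]

end Block

theorem middlePos_of_secondDifference [Finite σ]
    (h : ∀ (n : ℕ) (Y H : σ → Matrix (Fin n) (Fin n) ℝ), (∀ i, (Y i).IsSymm) →
      (∀ i, (H i).IsSymm) → (∀ i, S i = false → H i = 0) → ∀ v : Fin n → ℝ,
      0 ≤ ∑ w ∈ T, c w * (v ⬝ᵥ (wordMulVec (Y + H) v w + wordMulVec (Y - H) v w -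
        (2 : ℝ) • wordMulVec Y v w))) :
    MiddlePos S c T := by
  intro κ _ Z η hZ hη
  obtain ⟨ι, _, Y, e, hY, hdual⟩ := exists_separating_matrices σ (T.sup List.length)
  have hex : ∀ i, ∃ G : Matrix κ ι ℝ, (∀ u : List σ, u.length ≤ T.sup List.length →
      G *ᵥ wordMulVec Y e u = η i u) ∧ (S i = false → G = 0) := by
    intro i
    by_cases hi : S i = false
    -- Outside `S` the prescribed border is zero, so the direction can be chosen to vanish there.
    · exact ⟨0, fun u _ => by rw [hη i u hi, zero_mulVec], fun _ => rfl⟩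
    · choose β hβ using fun k => hdual fun u => η i u k
      exact ⟨β, fun u hu => funext fun k => hβ k u hu, fun h => absurd h hi⟩
  choose G hG hG0 using hex
  have key := sum_wordHess_nonneg c T (fun i => fromBlocks (Y i) 0 0 (Z i))
    (fun i => fromBlocks 0 (G i)ᵀ (G i) 0) (Sum.elim e 0) ?_
  · refine key.trans_eq (Finset.sum_congr rfl fun w hw => ?_)
    have hlen : w.length ≤ T.sup List.length := Finset.le_sup (f := List.length) hw
    have := dotProduct_wordHess_block Y Z G e η hY _ hG [] w (by simpa using hlen)
    rw [wordMulVec] at this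
    rw [this]
  · intro s
    -- The hypothesis speaks of `Fin n`, so the block matrices are reindexed.
    let f := (Fintype.equivFin (ι ⊕ κ)).symm
    let Y' : σ → Matrix (ι ⊕ κ) (ι ⊕ κ) ℝ := fun i => fromBlocks (Y i) 0 0 (Z i)
    let H' : σ → Matrix (ι ⊕ κ) (ι ⊕ κ) ℝ := s • fun i => fromBlocks 0 (G i)ᵀ (G i) 0
    have h0 := h _ (fun i => (Y' i).submatrix f f) (fun i => (H' i).submatrix f f)
      (fun i => ((hY i).fromBlocks (by simp) (hZ i)).submatrix f)
      (fun i => by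
        refine IsSymm.submatrix (IsSymm.smul ?_ s) f
        exact isSymm_zero.fromBlocks (by simp) isSymm_zero)
      (fun i hi => by
        ext
        simp [H', hG0 i hi]) (Sum.elim e 0 ∘ f)
    have e1 : (fun i => (Y' i).submatrix f f) + (fun i => (H' i).submatrix f f) =
        fun i => ((Y' + H') i).submatrix f f := rfl
    have e2 : (fun i => (Y' i).submatrix f f) - (fun i => (H' i).submatrix f f) =
        fun i => ((Y' - H') i).submatrix f f := rfl
    rw [e1, e2] at h0
    refine h0.trans_eq (Finset.sum_congr rfl fun w hw => ?_)
    rw [wordMulVec_submatrix, wordMulVec_submatrix, wordMulVec_submatrix, neg_smul,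
      ← sub_eq_add_neg]
    congr 1
    exact comp_equiv_dotProduct_comp_equiv (Sum.elim e 0 : ι ⊕ κ → ℝ)
      (wordMulVec (Y' + H') (Sum.elim e 0) w + wordMulVec (Y' - H') (Sum.elim e 0) w -
        (2 : ℝ) • wordMulVec Y' (Sum.elim e 0) w) f

end Hessian

/-! ### Coefficients, evaluation, and sums of squares for noncommutative polynomials. -/

namespace NCPoly

open Matrix

variable {ga gx : ℕ}

/-- The coefficients of `p`, as a function on lists of letters. -/
noncomputable def listCoeff (p : NCPoly ga gx) (w : List (Fin ga ⊕ Fin gx)) : ℝ :=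
  p.coeff (FreeMonoid.ofList w)

/-- The words with a nonzero coefficient in `p`. -/
noncomputable def words (p : NCPoly ga gx) : Finset (List (Fin ga ⊕ Fin gx)) :=
  (FreeAlgebra.equivMonoidAlgebraFreeMonoid p).coeff.support.map
    FreeMonoid.toList.toEmbedding

theorem mem_words (p : NCPoly ga gx) (w : List (Fin ga ⊕ Fin gx)) (h : p.listCoeff w ≠ 0) :
    w ∈ p.words := by
  simpa [words, listCoeff, coeff] using h

theorem coeff_sub (p q : NCPoly ga gx) (w) : (p - q).coeff w = p.coeff w - q.coeff w := by
  simp [coeff]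

theorem coeff_add (p q : NCPoly ga gx) (w) : (p + q).coeff w = p.coeff w + q.coeff w := by
  simp [coeff]

theorem coeff_smul (t : ℝ) (p : NCPoly ga gx) (w) : (t • p).coeff w = t * p.coeff w := by
  simp [coeff]

theorem coeff_sum {ι : Type*} (s : Finset ι) (f : ι → NCPoly ga gx) (w) :
    (∑ i ∈ s, f i).coeff w = ∑ i ∈ s, (f i).coeff w := by
  simp [coeff]

open Classical in
theorem coeff_word (u : List (Fin ga ⊕ Fin gx)) (w : FreeMonoid (Fin ga ⊕ Fin gx)) :
    coeff (u.map (FreeAlgebra.ι ℝ)).prod w = if u = FreeMonoid.toList w then 1 else 0 := by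
  have : FreeAlgebra.equivMonoidAlgebraFreeMonoid (u.map (FreeAlgebra.ι ℝ)).prod =
      MonoidAlgebra.single (FreeMonoid.ofList u) (1 : ℝ) := by
    induction u with
    | nil => simp; rfl
    | cons i u ih =>
      rw [List.map_cons, List.prod_cons, map_mul, ih]
      simp [FreeAlgebra.equivMonoidAlgebraFreeMonoid, MonoidAlgebra.single_mul_single]
  rw [coeff, this, MonoidAlgebra.coeff_single, Finsupp.single_apply]
  exact if_congr Iff.rfl rfl rfl

theorem lift_eq_sum {R : Type*} [Ring R] [Algebra ℝ R] (f : Fin ga ⊕ Fin gx → R)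
    (p : NCPoly ga gx) :
    FreeAlgebra.lift ℝ f p = ∑ w ∈ p.words, p.listCoeff w • (w.map f).prod := by
  have h : FreeAlgebra.lift ℝ f = (MonoidAlgebra.lift ℝ R _ (FreeMonoid.lift f)).comp
      (FreeAlgebra.equivMonoidAlgebraFreeMonoid :
        NCPoly ga gx ≃ₐ[ℝ] _).toAlgHom := by
    ext i
    simp [FreeAlgebra.equivMonoidAlgebraFreeMonoid]
  rw [h, AlgHom.comp_apply]
  change MonoidAlgebra.lift ℝ R _ (FreeMonoid.lift f)
    (FreeAlgebra.equivMonoidAlgebraFreeMonoid p) = _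
  rw [MonoidAlgebra.lift_apply, Finsupp.sum, words, Finset.sum_map]
  refine Finset.sum_congr rfl fun w _ => ?_
  rw [FreeMonoid.lift_apply]
  rfl

theorem eq_sum_words (p : NCPoly ga gx) :
    p = ∑ w ∈ p.words, p.listCoeff w • (w.map (FreeAlgebra.ι ℝ)).prod := by
  have h : FreeAlgebra.lift ℝ (FreeAlgebra.ι ℝ) = AlgHom.id ℝ (NCPoly ga gx) := by
    ext
    simp
  rw [← lift_eq_sum, h]
  rfl

theorem star_word (u : List (Fin ga ⊕ Fin gx)) :
    star (u.map (FreeAlgebra.ι ℝ)).prod = (u.reverse.map (FreeAlgebra.ι ℝ)).prod := by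
  induction u with
  | nil => simp
  | cons i u ih => simp [ih]

theorem star_smul' (t : ℝ) (p : NCPoly ga gx) : star (t • p) = t • star p := by
  rw [Algebra.smul_def, star_mul, FreeAlgebra.star_algebraMap, Algebra.smul_def,
    Algebra.commutes]

theorem listCoeff_star (p : NCPoly ga gx) (w : List (Fin ga ⊕ Fin gx)) :
    (star p).listCoeff w = p.listCoeff w.reverse := by
  classical
  conv_lhs => rw [eq_sum_words p]
  conv_rhs => rw [eq_sum_words p]
  simp only [listCoeff, star_sum, coeff_sum, star_smul', coeff_smul, star_word, coeff_word]
  refine Finset.sum_congr rfl fun u _ => ?_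
  congr 1
  exact if_congr List.reverse_eq_iff rfl rfl

theorem prod_map_mulVec {σ κ : Type*} [Fintype κ] [DecidableEq κ] (Y : σ → Matrix κ κ ℝ)
    (v : κ → ℝ) (w : List σ) : (w.map Y).prod *ᵥ v = wordMulVec Y v w := by
  induction w with
  | nil => simp [wordMulVec]
  | cons i w ih => rw [List.map_cons, List.prod_cons, ← mulVec_mulVec, ih, wordMulVec]

theorem eval_mulVec {n : ℕ} (p : NCPoly ga gx) (A : Fin ga → Matrix (Fin n) (Fin n) ℝ)
    (X : Fin gx → Matrix (Fin n) (Fin n) ℝ) (v : Fin n → ℝ) :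
    p.eval A X *ᵥ v = ∑ w ∈ p.words, p.listCoeff w • wordMulVec (Sum.elim A X) v w := by
  rw [eval, lift_eq_sum, sum_mulVec]
  simp [smul_mulVec, prod_map_mulVec]

theorem dotProduct_eval_mulVec {n : ℕ} (p : NCPoly ga gx)
    (A : Fin ga → Matrix (Fin n) (Fin n) ℝ)
    (X : Fin gx → Matrix (Fin n) (Fin n) ℝ) (v : Fin n → ℝ) :
    v ⬝ᵥ (p.eval A X *ᵥ v) =
      ∑ w ∈ p.words, p.listCoeff w * (v ⬝ᵥ wordMulVec (Sum.elim A X) v w) := by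
  simp [eval_mulVec, dotProduct_sum]

theorem ConvexInX.middlePos {p : NCPoly ga gx} (h : p.ConvexInX) :
    MiddlePos Sum.isRight p.listCoeff p.words := by
  refine middlePos_of_secondDifference fun n Y H hY hH hH0 v => ?_
  -- Midpoint convexity between `Y + H` and `Y - H` is the second difference inequality.
  have h1 := (h n (Y ∘ Sum.inl) ((Y + H) ∘ Sum.inr) ((Y - H) ∘ Sum.inr) (fun i => hY _)
    (fun i => (hY _).add (hH _)) (fun i => (hY _).sub (hH _)) (1 / 2) (by norm_num)
    (by norm_num)).dotProduct_mulVec_nonneg v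
  have e1 : Sum.elim (Y ∘ Sum.inl) ((Y + H) ∘ Sum.inr) = Y + H := by
    ext (i | i)
    · simp [hH0 (Sum.inl i) rfl]
    · simp
  have e2 : Sum.elim (Y ∘ Sum.inl) ((Y - H) ∘ Sum.inr) = Y - H := by
    ext (i | i)
    · simp [hH0 (Sum.inl i) rfl]
    · simp
  have e3 : Sum.elim (Y ∘ Sum.inl) ((1 / 2 : ℝ) • (Y + H) ∘ Sum.inr +
      (1 - 1 / 2 : ℝ) • (Y - H) ∘ Sum.inr) = Y := by
    ext (i | i) <;> simp; ring
  simp only [star_trivial, sub_mulVec, add_mulVec, smul_mulVec, dotProduct_sub, dotProduct_add,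
    dotProduct_smul, dotProduct_eval_mulVec, e1, e2, e3, smul_eq_mul] at h1
  simp only [dotProduct_sub, dotProduct_add, dotProduct_smul, mul_add, mul_sub,
    Finset.sum_add_distrib, Finset.sum_sub_distrib, smul_eq_mul, mul_left_comm _ (2 : ℝ),
    ← Finset.mul_sum]
  linarith

theorem ConcaveInA.middlePos {p : NCPoly ga gx} (h : p.ConcaveInA) :
    MiddlePos Sum.isLeft (-p.listCoeff) p.words := by
  refine middlePos_of_secondDifference fun n Y H hY hH hH0 v => ?_
  have h1 := (h n ((Y + H) ∘ Sum.inl) ((Y - H) ∘ Sum.inl) (Y ∘ Sum.inr)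
    (fun i => (hY _).add (hH _)) (fun i => (hY _).sub (hH _)) (fun i => hY _) (1 / 2)
    (by norm_num) (by norm_num)).dotProduct_mulVec_nonneg v
  have e1 : Sum.elim ((Y + H) ∘ Sum.inl) (Y ∘ Sum.inr) = Y + H := by
    ext (i | i)
    · simp
    · simp [hH0 (Sum.inr i) rfl]
  have e2 : Sum.elim ((Y - H) ∘ Sum.inl) (Y ∘ Sum.inr) = Y - H := by
    ext (i | i)
    · simp
    · simp [hH0 (Sum.inr i) rfl]
  have e3 : Sum.elim ((1 / 2 : ℝ) • (Y + H) ∘ Sum.inl +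
      (1 - 1 / 2 : ℝ) • (Y - H) ∘ Sum.inl) (Y ∘ Sum.inr) = Y := by
    ext (i | i) <;> simp; ring
  simp only [star_trivial, sub_mulVec, add_mulVec, smul_mulVec, dotProduct_sub, dotProduct_add,
    dotProduct_smul, dotProduct_eval_mulVec, e1, e2, e3, smul_eq_mul] at h1
  simp only [dotProduct_sub, dotProduct_add, dotProduct_smul, mul_add, mul_sub, Pi.neg_apply,
    neg_mul, Finset.sum_add_distrib, Finset.sum_sub_distrib, Finset.sum_neg_distrib, smul_eq_mul,
    mul_left_comm _ (2 : ℝ), ← Finset.mul_sum]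
  linarith

open Classical in
/-- A positive semidefinite quadratic form in the letters of `S` is a sum of squares of linear
polynomials in these letters. -/
theorem exists_sum_star_mul_self (S : Fin ga ⊕ Fin gx → Bool)
    (c : List (Fin ga ⊕ Fin gx) → ℝ) (hrev : ∀ w, c w.reverse = c w)
    (hpos : ∀ α : Fin ga ⊕ Fin gx → ℝ, (∀ i, S i = false → α i = 0) →
      0 ≤ ∑ i, ∑ j, α i * α j * c [i, j]) :
    ∃ (m : ℕ) (r : Fin m → NCPoly ga gx),
      (∀ l w, (r l).coeff w ≠ 0 → ∃ i, S i = true ∧ FreeMonoid.toList w = [i]) ∧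
      (∀ i j, S i = true → S j = true →
        (∑ l, star (r l) * r l).coeff (FreeMonoid.ofList [i, j]) = c [i, j]) ∧
      ∀ w, (∑ l, star (r l) * r l).coeff w ≠ 0 →
        ∃ i j, S i = true ∧ S j = true ∧ FreeMonoid.toList w = [i, j] := by
  let C : Matrix (Fin ga ⊕ Fin gx) (Fin ga ⊕ Fin gx) ℝ :=
    fun i j => if S i = true ∧ S j = true then c [i, j] else 0
  have hC : C.PosSemidef := by
    refine PosSemidef.of_dotProduct_mulVec_nonneg ?_ fun x => ?_
    · ext i j
      have := hrev [j, i]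
      simp only [List.reverse_cons, List.reverse_nil, List.nil_append, List.cons_append] at this
      change star (C j i) = C i j
      simp [C, and_comm, this]
    · refine (hpos (fun i => if S i = true then x i else 0) (fun i hi => by simp [hi])).trans_eq ?_
      simp only [star_trivial, dotProduct, mulVec, Finset.mul_sum]
      refine Finset.sum_congr rfl fun i _ => Finset.sum_congr rfl fun j _ => ?_
      by_cases hi : S i = true <;> by_cases hj : S j = true <;> simp [C, hi, hj]
      ring
  obtain ⟨B, hB⟩ : ∃ B : Matrix (Fin ga ⊕ Fin gx) (Fin ga ⊕ Fin gx) ℝ, C = star B * B := by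
    open scoped MatrixOrder in
    exact CStarAlgebra.nonneg_iff_eq_star_mul_self.mp hC.nonneg
  have hBC : ∀ i j, ∑ l, B l i * B l j = C i j := by
    intro i j
    rw [hB]
    simp [mul_apply]
  -- A column of `B` over a letter outside `S` has squared norm `C j j = 0`, so the linear factors
  -- involve only letters of `S`.
  have hB0 : ∀ l j, ¬ S j = true → B l j = 0 := by
    intro l j hj
    have h1 := hBC j j
    have h2 : C j j = 0 := by simp [C, hj]
    rw [h2, Finset.sum_eq_zero_iff_of_nonneg (fun _ _ => mul_self_nonneg _)] at h1
    exact mul_self_eq_zero.1 (h1 l (Finset.mem_univ l))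
  let f := (Fintype.equivFin (Fin ga ⊕ Fin gx)).symm
  let r : Fin ga ⊕ Fin gx → NCPoly ga gx := fun l => ∑ j, B l j • ([j].map (FreeAlgebra.ι ℝ)).prod
  have hsum : ∑ l, star (r (f l)) * r (f l) =
      ∑ i, ∑ j, C i j • ([i, j].map (FreeAlgebra.ι ℝ)).prod := by
    rw [f.sum_comp fun l => star (r l) * r l]
    simp only [r, star_sum, star_smul', star_word, Finset.sum_mul_sum]
    rw [Finset.sum_comm]
    refine Finset.sum_congr rfl fun i _ => ?_
    rw [Finset.sum_comm]
    refine Finset.sum_congr rfl fun j _ => ?_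
    rw [← hBC, Finset.sum_smul]
    refine Finset.sum_congr rfl fun l _ => ?_
    rw [smul_mul_smul_comm]
    simp
  have hcoeff : ∀ w, (∑ l, star (r (f l)) * r (f l)).coeff w =
      ∑ i, ∑ j, C i j * if [i, j] = FreeMonoid.toList w then 1 else 0 := by
    intro w
    simp only [hsum, coeff_sum, coeff_smul, coeff_word]
  refine ⟨_, fun l => r (f l), fun l w hw => ?_, fun i j hi hj => ?_, fun w hw => ?_⟩
  · simp only [r, coeff_sum, coeff_smul, coeff_word] at hw
    obtain ⟨j, -, hj⟩ := Finset.exists_ne_zero_of_sum_ne_zero hw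
    refine ⟨j, ?_, ?_⟩
    · by_contra h
      simp [hB0 _ _ h] at hj
    · by_contra h
      exact hj (by rw [if_neg (Ne.symm h), mul_zero])
  · rw [hcoeff, Finset.sum_eq_single i, Finset.sum_eq_single j]
    · simp [C, hi, hj]
    · intro k _ hk
      simp [hk]
    · simp
    · intro k _ hk
      simp [hk]
    · simp
  · rw [hcoeff] at hw
    obtain ⟨i, -, hi⟩ := Finset.exists_ne_zero_of_sum_ne_zero hw
    obtain ⟨j, -, hj⟩ := Finset.exists_ne_zero_of_sum_ne_zero hi
    have hS : S i = true ∧ S j = true := by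
      by_contra h
      simp only [C, if_neg h, zero_mul, ne_eq, not_true_eq_false] at hj
    refine ⟨i, j, hS.1, hS.2, ?_⟩
    by_contra h
    exact hj (by rw [if_neg (Ne.symm h), mul_zero])

end NCPoly

/-! ### Assembly of the decomposition. -/

theorem mainTheorem5 (ga gx : ℕ) (p : NCPoly ga gx) (hsymm : star p = p)
    (hconv : p.ConvexInX) (hconc : p.ConcaveInA) :
    ∃ (m k : ℕ) (L : NCPoly ga gx) (r : Fin m → NCPoly ga gx) (s : Fin k → NCPoly ga gx),
      L.DegALE 1 ∧ L.DegXLE 1 ∧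
      (∀ j, (r j).IsLinearInXOnly) ∧ (∀ l, (s l).IsLinearInAOnly) ∧
      p = L + ∑ j, star (r j) * r j - ∑ l, star (s l) * s l := by
  have hT := p.mem_words
  have hT' : ∀ w, (-p.listCoeff) w ≠ 0 → w ∈ p.words := fun w hw => hT w (by simpa using hw)
  have hrev : ∀ w, p.listCoeff w.reverse = p.listCoeff w := fun w => by
    rw [← NCPoly.listCoeff_star, hsymm]
  have hrev' : ∀ w, (-p.listCoeff) w.reverse = (-p.listCoeff) w := by simpa using hrev
  have hX := hconv.middlePos
  have hA := hconc.middlePos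
  have hA' : MiddlePos (fun i => !Sum.isRight i) (-p.listCoeff) p.words := by simpa using hA
  have hX' : MiddlePos (fun i => !Sum.isLeft i) (-(-p.listCoeff)) p.words := by simpa using hX
  obtain ⟨m, r, hr, hr2, hr0⟩ := NCPoly.exists_sum_star_mul_self Sum.isRight p.listCoeff hrev
    (hX.pair_nonneg hA' hT hrev)
  obtain ⟨k, s, hs, hs2, hs0⟩ := NCPoly.exists_sum_star_mul_self Sum.isLeft (-p.listCoeff) hrev'
    (hA.pair_nonneg hX' hT' hrev')
  have hXw := hX.eq_pair_of_two_le_countP hA' hT hrev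
  have hAw := hA.eq_pair_of_two_le_countP hX' hT' hrev'
  -- With `L` defined as the difference, the degree bounds hold because words of degree at least two
  -- in one kind of letter have length two, and the squares match their coefficients exactly.
  refine ⟨m, k, p - ∑ j, star (r j) * r j + ∑ l, star (s l) * s l, r, s, ?_, ?_, ?_, ?_, by abel⟩
  · intro w hw
    by_contra! h2
    apply hw
    have h1 : NCPoly.coeff (∑ j, star (r j) * r j) w = 0 := by
      by_contra h
      obtain ⟨i, j, hi, hj, hwe⟩ := hr0 w h
      rw [NCPoly.wordDegA, hwe] at h2
      cases i <;> cases j <;> simp at hi hj h2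
    rw [NCPoly.coeff_add, NCPoly.coeff_sub, h1]
    by_cases hij : ∃ i j, i.isLeft = true ∧ j.isLeft = true ∧ FreeMonoid.toList w = [i, j]
    · obtain ⟨i, j, hi, hj, hwe⟩ := hij
      have hw' : w = FreeMonoid.ofList [i, j] := hwe
      rw [hw', hs2 i j hi hj]
      simp [NCPoly.listCoeff]
    · have h3 : NCPoly.coeff (∑ l, star (s l) * s l) w = 0 := by
        by_contra h
        exact hij (hs0 w h)
      have h4 : p.coeff w = 0 := by
        by_contra h
        exact hij (hAw (FreeMonoid.toList w) (by simpa [NCPoly.listCoeff] using h) h2)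
      rw [h3, h4]; simp
  · intro w hw
    by_contra! h2
    apply hw
    have h1 : NCPoly.coeff (∑ l, star (s l) * s l) w = 0 := by
      by_contra h
      obtain ⟨i, j, hi, hj, hwe⟩ := hs0 w h
      rw [NCPoly.wordDegX, hwe] at h2
      cases i <;> cases j <;> simp at hi hj h2
    rw [NCPoly.coeff_add, NCPoly.coeff_sub, h1]
    by_cases hij : ∃ i j, i.isRight = true ∧ j.isRight = true ∧ FreeMonoid.toList w = [i, j]
    · obtain ⟨i, j, hi, hj, hwe⟩ := hij
      have hw' : w = FreeMonoid.ofList [i, j] := hwe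
      rw [hw', hr2 i j hi hj]
      simp [NCPoly.listCoeff]
    · have h3 : NCPoly.coeff (∑ j, star (r j) * r j) w = 0 := by
        by_contra h
        exact hij (hr0 w h)
      have h4 : p.coeff w = 0 := by
        by_contra h
        exact hij (hXw (FreeMonoid.toList w) (by simpa [NCPoly.listCoeff] using h) h2)
      rw [h3, h4]; simp
  · intro j w hw
    obtain ⟨i, hi, hwe⟩ := hr j w hw
    rw [NCPoly.wordDegA, NCPoly.wordDegX, hwe]
    cases i <;> simp at hi ⊢
  · intro j w hw
    obtain ⟨i, hi, hwe⟩ := hs j w hw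
    rw [NCPoly.wordDegA, NCPoly.wordDegX, hwe]
    cases i <;> simp at hi ⊢
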